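/- Let $d,t\ge 0$ be integers, let $h_1,\dots,h_t\in\mathbb{R}^d$ be vectors such that the additive subgroup $h_1\mathbb{Z}+\cdots+h_t\mathbb{Z}$ is dense in $\mathbb{R}^d$, and let $m_1,\dots,m_t\ge 0$ be integers. For $f:\mathbb{R}^d\to\mathbb{C}$, $h\in\mathbb{R}^d$ and an integer $m\ge 0$ put $(\Delta_h^m f)(x)=\sum_{j=0}^{m}(-1)^{m-j}\binom{m}{j}f(x+jh)$, and similarly for test functions; for a complex-valued Schwartz distribution $T\in\mathcal{D}'(\mathbb{R}^d)$ put $(\Delta_h^m T)\{\varphi\}=T\{\Delta_{-h}^m\varphi\}$ for every test function $\varphi$. A continuous exponential polynomial on $\mathbb{R}^d$ is a function of the form $x\mapsto\sum_{j=1}^{n}p_j(x)\,e^{\langle\lambda_j,x\rangle}$ with $n\ge 0$, $p_j\in\mathbb{C}[x_1,\dots,x_d]$, $\lambda_j\in\mathbb{C}^d$ and $\langle\lambda,x\rangle=\sum_i\lambda_i x_i$. A distribution $T$ is said to be a continuous exponential polynomial if there is such a function $g$ with $T\{\varphi\}=\int_{\mathbb{R}^d}\varphi(x)g(x)\,dx$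 for every test function $\varphi$. Then: (a) if $f:\mathbb{R}^d\to\mathbb{C}$ is continuous and $\Delta_{h_k}^{m_k}f$ is a continuous exponential polynomial for every $k\in\{1,\dots,t\}$, then $f$ is a continuous exponential polynomial; (b) if $T\in\mathcal{D}'(\mathbb{R}^d)$ is a complex-valued distribution and $\Delta_{h_k}^{m_k}T$ is a continuous exponential polynomial (as a distribution) for every $k\in\{1,\dots,t\}$, then $T$ is a continuous exponential polynomial (as a distribution). -/

import Mathlib

open TopologicalSpace MeasureTheory
open scoped Distributions

namespace ExpPolyDiff

/-- Euclidean space `ℝ^d`. -/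
abbrev Eucl (d : ℕ) : Type := EuclideanSpace ℝ (Fin d)

/-- A continuous exponential polynomial on `ℝ^d`: a finite sum of products `p(x) * e^{⟨λ, x⟩}` with
`p` a complex polynomial in `d` variables and `λ ∈ ℂ^d`. The empty sum (the zero function) is
allowed. -/
def IsExpPoly {d : ℕ} (f : Eucl d → ℂ) : Prop :=
  ∃ (n : ℕ) (p : Fin n → MvPolynomial (Fin d) ℂ) (lam : Fin n → Fin d → ℂ),
    ∀ x : Eucl d, f x = ∑ j : Fin n,
      MvPolynomial.eval (fun i => (x i : ℂ)) (p j) * Complex.exp (∑ i : Fin d, lam j i * (x i : ℂ))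

/-- Exponential polynomials in the above sense are automatically continuous. -/
theorem IsExpPoly.continuous {d : ℕ} {f : Eucl d → ℂ} (hf : IsExpPoly f) : Continuous f := by
  obtain ⟨n, p, lam, h⟩ := hf
  rw [funext h]
  refine continuous_finsetSum _ fun j _ => Continuous.mul ?_ ?_
  · exact (MvPolynomial.continuous_eval (p j)).comp (by fun_prop)
  · fun_prop

/-- A complex-valued Schwartz distribution on `ℝ^d` is
a continuous `ℝ`-linear map from the space `𝓓(ℝ^d, ℝ)` of real test functions to `ℂ`
(equivalently, by complexification, a continuous `ℂ`-linear form on `𝓓(ℝ^d, ℂ)`). -/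
abbrev Distr (d : ℕ) : Type := 𝓓'((⊤ : Opens (Eucl d)), ℂ)

/-- Test functions on `ℝ^d`: smooth, real-valued and compactly supported. -/
abbrev TestFn (d : ℕ) : Type := 𝓓((⊤ : Opens (Eucl d)), ℝ)

theorem hasCompactSupport_comp_add {d : ℕ} (y : Eucl d) (φ : Eucl d → ℝ) (hφ : HasCompactSupport φ) :
    HasCompactSupport (fun x => φ (x + y)) :=
  hφ.comp_homeomorph (Homeomorph.addRight y)

/-- The translate `(τ_y φ)(x) = φ(x + y)` of a test function. -/
noncomputable def translateFun {d : ℕ} (y : Eucl d) (φ : TestFn d) : TestFn d where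
  toFun x := φ (x + y)
  contDiff' := φ.contDiff.comp (contDiff_id.add contDiff_const)
  hasCompactSupport' := hasCompactSupport_comp_add y φ φ.hasCompactSupport
  tsupport_subset' := fun _ _ => trivial

/-- The translate of a compact set `K` by `-y`. -/
def translateCompact {d : ℕ} (y : Eucl d) (K : Compacts (Eucl d)) : Compacts (Eucl d) :=
  K.map (fun x => x - y) (by fun_prop)

theorem notMem_of_notMem_translateCompact {d : ℕ} {y x : Eucl d} {K : Compacts (Eucl d)}
    (hx : x ∈ ((translateCompact y K : Compacts (Eucl d)) : Set (Eucl d))ᶜ) :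
    x + y ∈ (K : Set (Eucl d))ᶜ := by
  intro h
  exact hx ⟨x + y, h, by simp⟩

/-- Translation on the test functions supported in `K`. -/
noncomputable def translateOn {d : ℕ} (y : Eucl d) (K : Compacts (Eucl d)) :
    𝓓_{K}(Eucl d, ℝ) →L[ℝ] 𝓓_{translateCompact y K}(Eucl d, ℝ) :=
  ContDiffMapSupportedIn.mkCLM ℝ (fun φ x => φ (x + y))
    (fun _ _ _ => rfl) (fun _ _ _ => rfl)
    (fun φ => φ.contDiff.comp (contDiff_id.add contDiff_const))
    (fun φ _ hx => φ.zero_on_compl (notMem_of_notMem_translateCompact hx))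
    (fun i _ => ⟨{i}, 1, zero_le_one, fun φ x _ => by
      rw [iteratedFDeriv_comp_add_right, Finset.sup_singleton, one_mul]
      exact ContDiffMapSupportedIn.norm_iteratedFDeriv_apply_le_seminorm_top ℝ⟩)

/-- Translation `τ_y` as a continuous linear operator on the space of test functions. -/
noncomputable def translate {d : ℕ} (y : Eucl d) : TestFn d →L[ℝ] TestFn d :=
  TestFunction.limitCLM ℝ (translateFun y)
    (fun K _ => (TestFunction.ofSupportedInCLM ℝ
      (Ω := ⊤) (K := translateCompact y K) (fun _ _ => trivial)).comp (translateOn y K))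
    (fun _ _ _ => rfl)

theorem translate_apply {d : ℕ} (y : Eucl d) (φ : TestFn d) (x : Eucl d) :
    translate y φ x = φ (x + y) := rfl

/-- The forward difference operator `Δ_h^m = ∑_{k=0}^m (-1)^{m-k} (m choose k) τ_{kh}` on test
functions. -/
noncomputable def testDiff {d : ℕ} (h : Eucl d) (m : ℕ) : TestFn d →L[ℝ] TestFn d :=
  ∑ k ∈ Finset.range (m + 1), ((-1 : ℝ) ^ (m - k) * (m.choose k : ℝ)) • translate ((k : ℝ) • h)

theorem testDiff_apply {d : ℕ} (h : Eucl d) (m : ℕ) (φ : TestFn d) (x : Eucl d) :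
    testDiff h m φ x
      = ∑ k ∈ Finset.range (m + 1), (-1 : ℝ) ^ (m - k) * (m.choose k : ℝ) * φ (x + (k : ℝ) • h) := by
  let ev : TestFn d →+ ℝ := ⟨⟨fun ψ => ψ x, rfl⟩, fun _ _ => rfl⟩
  have : testDiff h m φ = ∑ k ∈ Finset.range (m + 1),
      ((-1 : ℝ) ^ (m - k) * (m.choose k : ℝ)) • translate ((k : ℝ) • h) φ := by
    simp [testDiff]
  rw [this]
  exact map_sum ev _ _

/-- The forward difference of a function, `Δ_h^m f = ∑_{k=0}^m (-1)^{m-k} (m choose k) τ_{kh} f`. -/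
noncomputable def funDiff {d : ℕ} (h : Eucl d) (m : ℕ) (f : Eucl d → ℂ) : Eucl d → ℂ :=
  fun x => ∑ k ∈ Finset.range (m + 1), (-1 : ℂ) ^ (m - k) * (m.choose k : ℂ) * f (x + (k : ℝ) • h)

/-- The closed formula is the `m`-fold iterate of `(Δ_h f)(x) = f (x + h) - f x`. -/
theorem funDiff_eq_iterate {d : ℕ} (h : Eucl d) (m : ℕ) (f : Eucl d → ℂ) :
    funDiff h m f = (fwdDiff h)^[m] f := by
  ext x
  rw [fwdDiff_iter_eq_sum_shift]
  refine Finset.sum_congr rfl fun k _ => ?_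
  rw [zsmul_eq_mul, Nat.cast_smul_eq_nsmul]
  push_cast
  rfl

/-- The forward difference of a distribution, `(Δ_h^m T){φ} = T{Δ_{-h}^m φ}`. -/
noncomputable def distrDiff {d : ℕ} (h : Eucl d) (m : ℕ) (T : Distr d) : Distr d :=
  (testDiff (-h) m).precompCompactConvergenceCLM ℂ T

theorem distrDiff_apply {d : ℕ} (h : Eucl d) (m : ℕ) (T : Distr d) (φ : TestFn d) :
    distrDiff h m T φ = T (testDiff (-h) m φ) := rfl

/-- The distribution `T` is the regular distribution given by a continuous exponential polynomial
`g`, i.e. `T{φ} = ∫ φ g` for all test functions `φ`. -/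
def IsExpPolyDistr {d : ℕ} (T : Distr d) : Prop :=
  ∃ g : Eucl d → ℂ, IsExpPoly g ∧ ∀ φ : TestFn d, T φ = ∫ x : Eucl d, (φ x : ℂ) * g x

end ExpPolyDiff

/-! The proof characterises exponential polynomials by finite-dimensional translation-invariant
spaces. Let `τ` denote the translation action on all functions, or on all functionals on test
functions. Then `Δ_h^m` is `(τ h - 1) ^ m`, up to the sign of `h` for distributions.

The given right-hand sides lie in a finite-dimensional invariant space `W`. Adjoin `u` to `W` and
close up under the commuting operators `τ (h k) - 1`. The dimension stays finite, because the power
`m k` already falls back into `W` (`exists_finiteDimensional_invariant`). The stabiliser of the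
resulting space `Z` is a closed subgroup of `ℝ^d` containing every `h k`, so by density it is
everything (`invariant_of_dense`).

On `Z` the group acts by a continuous finite-dimensional representation. Its matrix coefficients are
exponential polynomials, by differentiability of one-parameter groups and the generalized
eigenspaces of their generators (`isExpPoly_representation`). For a continuous `f`, the identity `f
x = (τ x f) 0` exhibits `f` as such a coefficient. A distribution in `Z` has no point values.
Instead, averaging over translations against a narrow bump is invertible on `Z`, so `T` is the
smoothing of another element of `Z`, and its density is again a matrix coefficient
(`isExpPolyDistr_of_invariant`). -/

namespace ExpPolyDiff

variable {d : ℕ}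

/-! ### The algebra of exponential polynomials. -/

namespace IsExpPoly

theorem single (p : MvPolynomial (Fin d) ℂ) (lam : Fin d → ℂ) :
    IsExpPoly fun x : Eucl d =>
      MvPolynomial.eval (fun i => (x i : ℂ)) p * Complex.exp (∑ i : Fin d, lam i * (x i : ℂ)) :=
  ⟨1, fun _ => p, fun _ => lam, fun x => by simp⟩

theorem zero : IsExpPoly fun _ : Eucl d => (0 : ℂ) :=
  ⟨0, Fin.elim0, Fin.elim0, fun x => by simp⟩

theorem add {f g : Eucl d → ℂ} (hf : IsExpPoly f) (hg : IsExpPoly g) :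
    IsExpPoly fun x => f x + g x := by
  obtain ⟨n, p, a, hf⟩ := hf
  obtain ⟨m, q, b, hg⟩ := hg
  refine ⟨n + m, Fin.append p q, Fin.append a b, fun x => ?_⟩
  simp [Fin.sum_univ_add, hf, hg]

theorem sum {ι : Type*} (s : Finset ι) {f : ι → Eucl d → ℂ} (hf : ∀ i ∈ s, IsExpPoly (f i)) :
    IsExpPoly fun x => ∑ i ∈ s, f i x := by
  classical
  induction s using Finset.induction_on with
  | empty => simpa using zero
  | insert a s ha ih =>
    simp only [Finset.sum_insert ha]
    exact (hf a (by simp)).add (ih fun i hi => hf i (by simp [hi]))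

theorem mul {f g : Eucl d → ℂ} (hf : IsExpPoly f) (hg : IsExpPoly g) :
    IsExpPoly fun x => f x * g x := by
  obtain ⟨n, p, a, hf⟩ := hf
  obtain ⟨m, q, b, hg⟩ := hg
  simp only [hf, hg, Finset.sum_mul_sum]
  refine sum _ fun j _ => sum _ fun k _ => ?_
  convert single (p j * q k) (a j + b k) using 2 with x
  simp only [Pi.add_apply, add_mul, Finset.sum_add_distrib, Complex.exp_add, map_mul]
  ring

theorem const (c : ℂ) : IsExpPoly fun _ : Eucl d => c := by
  simpa using single (d := d) (MvPolynomial.C c) 0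

theorem coord (i : Fin d) : IsExpPoly fun x : Eucl d => (x i : ℂ) := by
  simpa using single (d := d) (MvPolynomial.X i) 0

theorem pow {f : Eucl d → ℂ} (hf : IsExpPoly f) (n : ℕ) : IsExpPoly fun x => f x ^ n := by
  induction n with
  | zero => simpa using const 1
  | succ n ih => simpa only [pow_succ] using ih.mul hf

theorem exp_coord (c : ℂ) (i : Fin d) :
    IsExpPoly fun x : Eucl d => Complex.exp ((x i : ℂ) * c) := by
  classical
  convert single (d := d) 1 (Pi.single i c) using 2 with x
  simp [Pi.single_apply, mul_comm]

theorem comp_neg {f : Eucl d → ℂ} (hf : IsExpPoly f) : IsExpPoly fun x => f (-x) := by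
  obtain ⟨n, p, a, hf⟩ := hf
  simp only [hf]
  refine sum _ fun j _ => ?_
  convert single (MvPolynomial.aeval (fun i => -MvPolynomial.X i) (p j)) (-a j) using 2 with x
  have : MvPolynomial.eval (fun i => (((-x) i : ℝ) : ℂ)) (p j) =
      MvPolynomial.eval (fun i => (x i : ℂ))
        (MvPolynomial.aeval (fun i => -MvPolynomial.X i) (p j)) := by
    induction p j using MvPolynomial.induction_on with
    | C c => simp
    | add p q hp hq => simp only [map_add, hp, hq]
    | mul_X p i hp => simp only [map_mul, hp]; simp
  rw [this]
  simp

end IsExpPoly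

/-! ### Exponential polynomials span finite-dimensional translation-invariant spaces. -/

/-- A function lies in a finite-dimensional translation-invariant space of functions. -/
def IsRepresentative (f : Eucl d → ℂ) : Prop :=
  ∃ S : Submodule ℂ (Eucl d → ℂ), S.FG ∧ f ∈ S ∧ ∀ g ∈ S, ∀ y, (fun x => g (x + y)) ∈ S

namespace IsRepresentative

theorem add {f g : Eucl d → ℂ} (hf : IsRepresentative f) (hg : IsRepresentative g) :
    IsRepresentative fun x => f x + g x := by
  obtain ⟨S, hS, hfS, hSt⟩ := hf
  obtain ⟨R, hR, hgR, hRt⟩ := hg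
  refine ⟨S ⊔ R, hS.sup hR, Submodule.add_mem_sup hfS hgR, fun u hu y => ?_⟩
  obtain ⟨a, ha, b, hb, rfl⟩ := Submodule.mem_sup.1 hu
  exact Submodule.add_mem_sup (hSt a ha y) (hRt b hb y)

theorem mul {f g : Eucl d → ℂ} (hf : IsRepresentative f) (hg : IsRepresentative g) :
    IsRepresentative fun x => f x * g x := by
  obtain ⟨S, hS, hfS, hSt⟩ := hf
  obtain ⟨R, hR, hgR, hRt⟩ := hg
  refine ⟨S * R, hS.mul hR, Submodule.mul_mem_mul hfS hgR, fun u hu y => ?_⟩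
  induction hu using Submodule.mul_induction_on' with
  | mem_mul_mem a ha b hb => exact Submodule.mul_mem_mul (hSt a ha y) (hRt b hb y)
  | add a _ b _ ha hb => exact add_mem ha hb

theorem of_span (s : Finset (Eucl d → ℂ)) {f : Eucl d → ℂ} (hf : f ∈ s)
    (h : ∀ g ∈ s, ∀ y, (fun x => g (x + y)) ∈ Submodule.span ℂ (s : Set (Eucl d → ℂ))) :
    IsRepresentative f := by
  refine ⟨Submodule.span ℂ s, ⟨s, rfl⟩, Submodule.subset_span hf, fun g hg y => ?_⟩
  let L : (Eucl d → ℂ) →ₗ[ℂ] (Eucl d → ℂ) := LinearMap.funLeft ℂ ℂ (· + y)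
  exact (Submodule.span_le.2 fun g hg => h g hg y :
    Submodule.span ℂ (s : Set (Eucl d → ℂ)) ≤ (Submodule.span ℂ s).comap L) hg

theorem const (c : ℂ) : IsRepresentative fun _ : Eucl d => c := by
  classical
  refine of_span {fun _ => c} (by simp) fun g hg y => ?_
  obtain rfl : g = fun _ => c := by simpa using hg
  exact Submodule.subset_span (by simp)

theorem sum {ι : Type*} (s : Finset ι) {f : ι → Eucl d → ℂ} (hf : ∀ i ∈ s, IsRepresentative (f i)) :
    IsRepresentative fun x => ∑ i ∈ s, f i x := by
  classical
  induction s using Finset.induction_on with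
  | empty => simpa using const 0
  | insert a s ha ih =>
    simp only [Finset.sum_insert ha]
    exact (hf a (by simp)).add (ih fun i hi => hf i (by simp [hi]))

theorem coord (i : Fin d) : IsRepresentative fun x : Eucl d => (x i : ℂ) := by
  classical
  refine of_span {fun _ => 1, fun x => (x i : ℂ)} (by simp) fun g hg y => ?_
  rw [Finset.mem_insert, Finset.mem_singleton] at hg
  obtain rfl | rfl := hg
  · exact Submodule.subset_span (by simp)
  · rw [Finset.coe_insert, Finset.coe_singleton, Submodule.mem_span_pair]
    refine ⟨y i, 1, ?_⟩
    ext x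
    simp [add_comm]

theorem exp (a : Fin d → ℂ) :
    IsRepresentative fun x : Eucl d => Complex.exp (∑ i : Fin d, a i * (x i : ℂ)) := by
  refine of_span {fun x => Complex.exp (∑ i : Fin d, a i * (x i : ℂ))} (by simp) fun g hg y => ?_
  obtain rfl := Finset.mem_singleton.1 hg
  rw [Finset.coe_singleton, Submodule.mem_span_singleton]
  refine ⟨Complex.exp (∑ i : Fin d, a i * (y i : ℂ)), ?_⟩
  ext x
  simp [← Complex.exp_add, mul_add, Finset.sum_add_distrib, add_comm]

theorem eval (p : MvPolynomial (Fin d) ℂ) :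
    IsRepresentative fun x : Eucl d => MvPolynomial.eval (fun i => (x i : ℂ)) p := by
  induction p using MvPolynomial.induction_on with
  | C c => simpa using const c
  | add p q hp hq => simpa using hp.add hq
  | mul_X p i hp => simpa using hp.mul (coord i)

end IsRepresentative

theorem IsExpPoly.isRepresentative {f : Eucl d → ℂ} (hf : IsExpPoly f) : IsRepresentative f := by
  obtain ⟨n, p, a, hf⟩ := hf
  rw [funext hf]
  exact IsRepresentative.sum _ fun j _ =>
    (IsRepresentative.eval (p j)).mul (IsRepresentative.exp (a j))

/-- A finite-dimensional translation-invariant space of continuous functions containing finitely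
many given exponential polynomials. -/
theorem exists_invariant_of_isExpPoly {ι : Type*} [Finite ι] {g : ι → Eucl d → ℂ}
    (hg : ∀ k, IsExpPoly (g k)) :
    ∃ S : Submodule ℂ (Eucl d → ℂ), FiniteDimensional ℂ S ∧ (∀ k, g k ∈ S) ∧
      (∀ f ∈ S, Continuous f) ∧ ∀ f ∈ S, ∀ y, (fun x => f (x + y)) ∈ S := by
  choose S hS hgS hSt using fun k => (hg k).isRepresentative
  -- The spaces `S k` may contain discontinuous functions; intersecting with the continuous ones
  -- keeps invariance and finite dimension.
  let C : Submodule ℂ (Eucl d → ℂ) :=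
    { carrier := {f | Continuous f}
      add_mem' := fun ha hb => Continuous.add ha hb
      zero_mem' := continuous_const
      smul_mem' := fun c _ hf => Continuous.const_smul hf c }
  have := Fintype.ofFinite ι
  have hfin : FiniteDimensional ℂ ↥(⨆ k, S k) := by
    have (k : ι) : FiniteDimensional ℂ (S k) := Module.Finite.iff_fg.2 (hS k)
    infer_instance
  refine ⟨(⨆ k, S k) ⊓ C, Submodule.finiteDimensional_of_le inf_le_left,
    fun k => ⟨Submodule.mem_iSup_of_mem k (hgS k), (hg k).continuous⟩, fun f hf => hf.2,
    fun f hf y => ⟨?_, Continuous.comp hf.2 (by fun_prop)⟩⟩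
  let L : (Eucl d → ℂ) →ₗ[ℂ] (Eucl d → ℂ) := LinearMap.funLeft ℂ ℂ (· + y)
  have hle : ⨆ k, S k ≤ (⨆ k, S k).comap L :=
    iSup_le fun k f hf => Submodule.mem_iSup_of_mem k (hSt k f hf y)
  exact hle hf.1

/-! ### Continuous finite-dimensional representations of `ℝ^d`. -/

/-- A continuous one-parameter semigroup in a Banach algebra has a generator. -/
theorem exists_generator {B : Type*} [NormedRing B] [NormedAlgebra ℝ B] [CompleteSpace B]
    {r : ℝ → B} (hr : Continuous r) (h0 : r 0 = 1) (hadd : ∀ s t, r (s + t) = r s * r t) :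
    ∃ A : B, ∀ s, HasDerivAt r (r s * A) s := by
  -- Since `I t / t → r 0 = 1` and units are open, some `I t` is invertible. Then `r s = (I (s + t)
  -- - I s) * (I t)⁻¹` is differentiable because `I` is.
  let I : ℝ → B := fun t => ∫ u in (0 : ℝ)..t, r u
  have hI (t : ℝ) : HasDerivAt I (r t) t := hr.integral_hasStrictDerivAt 0 t |>.hasDerivAt
  obtain ⟨t, ht⟩ : ∃ t, IsUnit (I t) := by
    have h1 := (hI 0).tendsto_slope_zero
    rw [h0] at h1
    obtain ⟨t, hu, ht⟩ := ((h1.eventually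
      (Units.isOpen.mem_nhds (show (1 : B) ∈ {x | IsUnit x} from isUnit_one))).and
      self_mem_nhdsWithin).exists
    have ht : t ≠ 0 := ht
    refine ⟨t, ?_⟩
    have hI0 : I 0 = 0 := by simp [I]
    simp only [zero_add, hI0, sub_zero] at hu
    have := (Units.mk0 t ht) • hu.unit
    have h2 : I t = (Units.mk0 t ht) • (t⁻¹ • I t) := by
      simp [Units.smul_def, smul_smul, ht]
    rw [h2]
    exact hu.smul _
  have hQ (s : ℝ) : r s * I t = I (s + t) - I s := by
    simp only [I]
    rw [intervalIntegral.integral_interval_sub_left (hr.intervalIntegrable _ _)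
      (hr.intervalIntegrable _ _)]
    have h1 := (ContinuousLinearMap.mul ℝ B (r s)).intervalIntegral_comp_comm
      (hr.intervalIntegrable (μ := volume) 0 t)
    simp only [ContinuousLinearMap.mul_apply', ← hadd] at h1
    rw [← h1]
    rw [intervalIntegral.integral_comp_add_left (fun u => r u) s, add_zero]
  obtain ⟨v, hv⟩ := ht
  refine ⟨(r t - 1) * ↑v⁻¹, fun s => ?_⟩
  have hrs : r = fun s => (I (s + t) - I s) * ↑v⁻¹ := by
    ext s
    rw [← hQ, ← hv, Units.mul_inv_cancel_right]
  have hd : HasDerivAt (fun s => (I (s + t) - I s) * ↑v⁻¹) ((r (s + t) - r s) * ↑v⁻¹) s :=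
    (((hI (s + t)).comp_add_const s t).sub (hI s)).mul_const _
  rw [← hrs] at hd
  convert hd using 1
  rw [hadd, ← mul_assoc, mul_sub, mul_one]

section OneParameter

variable {F : Type*} [NormedAddCommGroup F] [NormedSpace ℂ F]

/-- The orbit of a generalized eigenvector of the generator is an exponential times a
polynomial. -/
theorem exp_smul_semigroup_apply {r : ℝ → F →L[ℂ] F} {A : F →L[ℂ] F} (h0 : r 0 = 1)
    (hA : ∀ s, HasDerivAt r (r s * A) s) (c : ℂ) (N : ℕ) :
    ∀ v : F, (((A : F →ₗ[ℂ] F) - algebraMap ℂ (Module.End ℂ F) c) ^ N) v = 0 →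
      ∀ t : ℝ, Complex.exp (-(t * c)) • r t v = ∑ k ∈ Finset.range N,
        ((t : ℂ) ^ k / (k.factorial : ℂ)) •
          (((A : F →ₗ[ℂ] F) - algebraMap ℂ (Module.End ℂ F) c) ^ k) v := by
  set D : Module.End ℂ F := (A : F →ₗ[ℂ] F) - algebraMap ℂ (Module.End ℂ F) c with hD
  -- Differentiating the orbit twisted by `exp (-t c)` replaces `v` by `D v`, which lowers the
  -- nilpotency order and drives the induction.
  have hderiv (v : F) (t : ℝ) : HasDerivAt (fun t : ℝ => Complex.exp (-(t * c)) • r t v)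
      (Complex.exp (-(t * c)) • r t (D v)) t := by
    have h1 : HasDerivAt (fun t : ℝ => r t v) ((r t * A) v) t :=
      (((ContinuousLinearMap.apply ℂ F v).restrictScalars ℝ).hasFDerivAt.comp_hasDerivAt t (hA t))
    have h2 : HasDerivAt (fun t : ℝ => Complex.exp (-((t : ℂ) * c)))
        (Complex.exp (-(t * c)) * (-(1 * c))) t :=
      (((Complex.ofRealCLM.hasDerivAt (x := t)).mul_const c).neg).cexp
    have h3 : r t (D v) = (r t * A) v - c • r t v := by
      rw [← map_smul, mul_apply_eq_comp, ← map_sub]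
      rfl
    refine (h2.smul h1).congr_deriv ?_
    rw [h3]
    module
  induction N with
  | zero =>
    intro v hv t
    obtain rfl : v = 0 := by simpa using hv
    simp
  | succ N ih =>
    intro v hv t
    have hDv : (D ^ N) (D v) = 0 := by rw [← hv, pow_succ]; rfl
    let q : ℝ → F := fun t => ∑ k ∈ Finset.range (N + 1),
      ((t : ℂ) ^ k / (k.factorial : ℂ)) • (D ^ k) v
    have hq (t : ℝ) : HasDerivAt q (∑ k ∈ Finset.range N,
        ((t : ℂ) ^ k / (k.factorial : ℂ)) • (D ^ k) (D v)) t := by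
      have h1 : HasDerivAt q (∑ k ∈ Finset.range (N + 1),
          (((k : ℂ) * (t : ℂ) ^ (k - 1) * 1) / (k.factorial : ℂ)) • (D ^ k) v) t :=
        HasDerivAt.fun_sum fun k _ =>
          (((Complex.ofRealCLM.hasDerivAt (x := t)).pow k).div_const _).smul_const _
      convert h1 using 1
      rw [Finset.sum_range_succ']
      simp only [CharP.cast_eq_zero, zero_mul, zero_div, zero_smul, add_zero]
      refine Finset.sum_congr rfl fun k _ => ?_
      congr 1
      · rw [Nat.factorial_succ]
        push_cast
        have : (k : ℂ) + 1 ≠ 0 := Nat.cast_add_one_ne_zero k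
        have : (k.factorial : ℂ) ≠ 0 := Nat.cast_ne_zero.2 k.factorial_ne_zero
        field_simp
    have hc : ∀ t, HasDerivAt (fun t : ℝ => Complex.exp (-(t * c)) • r t v - q t) 0 t := by
      intro t
      have := (hderiv v t).sub (hq t)
      rwa [ih (D v) hDv t, sub_self] at this
    have h3 := is_const_of_deriv_eq_zero (fun t => (hc t).differentiableAt)
      (fun t => (hc t).deriv) t 0
    have hq0 : q 0 = v := by
      simp only [q]
      rw [Finset.sum_range_succ']
      simp
    simp only [hq0, h0] at h3
    rw [← sub_eq_zero]
    simpa using h3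

variable [FiniteDimensional ℂ F]

theorem isExpPoly_semigroup_apply {r : ℝ → F →L[ℂ] F} (hr : Continuous r) (h0 : r 0 = 1)
    (hadd : ∀ s t, r (s + t) = r s * r t) (l : F →ₗ[ℂ] ℂ) (v : F) (i : Fin d) :
    IsExpPoly fun x : Eucl d => l (r (x i) v) := by
  have : CompleteSpace F := FiniteDimensional.complete ℂ F
  obtain ⟨A, hA⟩ := exists_generator hr h0 hadd
  -- Over `ℂ` the generalized eigenspaces of the generator span, so by linearity `v` may be taken in
  -- one of them.
  have hv : v ∈ ⨆ c, Module.End.maxGenEigenspace (A : F →ₗ[ℂ] F) c := by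
    rw [Module.End.iSup_maxGenEigenspace_eq_top]
    trivial
  induction hv using Submodule.iSup_induction' with
  | zero => simpa using IsExpPoly.zero
  | add a b _ _ ha hb => simpa using ha.add hb
  | mem c v hv =>
    obtain ⟨N, hN⟩ := Module.End.mem_maxGenEigenspace _ _ _ |>.1 hv
    have key (t : ℝ) : l (r t v) = Complex.exp (t * c) * ∑ k ∈ Finset.range N,
        (t : ℂ) ^ k * (l ((((A : F →ₗ[ℂ] F) - algebraMap ℂ (Module.End ℂ F) c) ^ k) v) /
          (k.factorial : ℂ)) := by
      have h := congrArg l (exp_smul_semigroup_apply h0 hA c N v hN t)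
      simp only [map_smul, map_sum, smul_eq_mul] at h
      calc l (r t v) = Complex.exp (t * c) * (Complex.exp (-(t * c)) * l (r t v)) := by
            rw [← mul_assoc, ← Complex.exp_add]; simp
        _ = _ := by
            rw [h]
            congr 1
            exact Finset.sum_congr rfl fun k _ => by ring
    simp only [key]
    exact (IsExpPoly.exp_coord c i).mul
      (IsExpPoly.sum _ fun k _ => ((IsExpPoly.coord i).pow k).mul (IsExpPoly.const _))

/-- The matrix coefficients of a continuous finite-dimensional representation of `ℝ^d` are
exponential polynomials. -/
theorem isExpPoly_representation {ρ : Eucl d → F →L[ℂ] F} (hρ : Continuous ρ) (h0 : ρ 0 = 1)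
    (hadd : ∀ x y, ρ (x + y) = ρ x * ρ y) (l : F →ₗ[ℂ] ℂ) (v : F) :
    IsExpPoly fun x => l (ρ x v) := by
  classical
  let e : Fin d → Eucl d := fun i => EuclideanSpace.single i 1
  suffices H : ∀ s : Finset (Fin d), ∀ (l : F →ₗ[ℂ] ℂ) (v : F),
      IsExpPoly fun x : Eucl d => l (ρ (∑ i ∈ s, x i • e i) v) by
    have hx (x : Eucl d) : ∑ i, x i • e i = x := by
      ext j
      simp [e, Pi.single_apply]
    simpa only [hx] using H Finset.univ l v
  intro s
  induction s using Finset.induction_on with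
  | empty => intro l v; simpa using IsExpPoly.const _
  | insert i s hi ih =>
    intro l v
    let b := Module.finBasis ℂ F
    -- Matrix multiplication: a coefficient of a product is a sum of products of coefficients, which
    -- splits off one coordinate axis.
    have key (x : Eucl d) : l (ρ (∑ j ∈ insert i s, x j • e j) v) =
        ∑ j, b.coord j (ρ (∑ j ∈ s, x j • e j) v) * l (ρ (x i • e i) (b j)) := by
      rw [Finset.sum_insert hi, hadd, mul_apply_eq_comp]
      conv_lhs => rw [← b.sum_repr (ρ (∑ j ∈ s, x j • e j) v)]
      simp only [map_sum, map_smul, smul_eq_mul, Module.Basis.coord_apply]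
    simp only [key]
    refine IsExpPoly.sum _ fun j _ => (ih (b.coord j) v).mul ?_
    exact isExpPoly_semigroup_apply (r := fun t => ρ (t • e i)) (by fun_prop) (by simp [h0])
      (fun s t => by simp [add_smul, hadd]) l (b j) i

end OneParameter

/-! ### Finite-dimensional invariant subspaces, from generators to the whole group. -/

section Invariant

variable {M : Type*} [AddCommGroup M] [Module ℂ M]

/-- Given commuting operators `D k`, a finite-dimensional invariant subspace `W` and a vector `u`
with `(D k) ^ (m k) u ∈ W` for all `k`, there is a finite-dimensional invariant subspace
containing `u`. -/
theorem exists_finiteDimensional_invariant {ι : Type*} [Finite ι] {D : ι → Module.End ℂ M}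
    (hD : ∀ j k, Commute (D j) (D k)) {V W : Submodule ℂ M} (hWV : W ≤ V) [FiniteDimensional ℂ W]
    (hVD : ∀ k, V ≤ V.comap (D k)) (hWD : ∀ k, W ≤ W.comap (D k)) {m : ι → ℕ} {u : M} (hu : u ∈ V)
    (hm : ∀ k, (D k ^ m k) u ∈ W) :
    ∃ Z : Submodule ℂ M, FiniteDimensional ℂ Z ∧ u ∈ Z ∧ Z ≤ V ∧ ∀ k, Z ≤ Z.comap (D k) := by
  classical
  have := Fintype.ofFinite ι
  have hWpow (k : ι) (n : ℕ) : ∀ w ∈ W, (D k ^ n) w ∈ W := by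
    induction n with
    | zero => exact fun w hw => hw
    | succ n ih => exact fun w hw => by rw [pow_succ]; exact ih _ (hWD k hw)
  have hVpow (k : ι) (n : ℕ) : ∀ w ∈ V, (D k ^ n) w ∈ V := by
    induction n with
    | zero => exact fun w hw => hw
    | succ n ih => exact fun w hw => by rw [pow_succ]; exact ih _ (hVD k hw)
  -- Closing up under one operator at a time works because `W ≤ Z` and `(D k ^ m k) Z ⊆ W`, for all
  -- `k`, survive each enlargement.
  suffices H : ∀ s : Finset ι, ∃ Z : Submodule ℂ M, FiniteDimensional ℂ Z ∧ u ∈ Z ∧ Z ≤ V ∧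
      W ≤ Z ∧ (∀ k, ∀ z ∈ Z, (D k ^ m k) z ∈ W) ∧ ∀ k ∈ s, Z ≤ Z.comap (D k) by
    obtain ⟨Z, h1, h2, h3, -, -, h4⟩ := H Finset.univ
    exact ⟨Z, h1, h2, h3, fun k => h4 k (Finset.mem_univ k)⟩
  intro s
  induction s using Finset.induction_on with
  | empty =>
    refine ⟨W ⊔ Submodule.span ℂ {u}, inferInstance,
      Submodule.mem_sup_right (Submodule.mem_span_singleton_self u), ?_, le_sup_left, ?_, by simp⟩
    · exact sup_le hWV (by simpa using hu)
    · intro k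
      have : W ⊔ Submodule.span ℂ {u} ≤ W.comap (D k ^ m k) :=
        sup_le (hWpow k _) (by simpa using hm k)
      exact this
  | insert a s _ ih =>
    obtain ⟨Z, hfin, huZ, hZV, hWZ, hZm, hZs⟩ := ih
    -- The exponents run from `0` to `m a`, so `Z ≤ Z'` even if `m a = 0`. The next power maps `Z`
    -- into `D a` applied to `W`, hence into `W ≤ Z'`.
    let Z' : Submodule ℂ M := ⨆ i : Fin (m a + 1), Z.map (D a ^ (i : ℕ))
    have hmem (i : ℕ) (hi : i < m a + 1) {z : M} (hz : z ∈ Z) : (D a ^ i) z ∈ Z' :=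
      Submodule.mem_iSup_of_mem (⟨i, hi⟩ : Fin (m a + 1)) (Submodule.mem_map_of_mem hz)
    have hZZ' : Z ≤ Z' := fun z hz => hmem 0 (Nat.succ_pos _) hz
    have hle {X : Submodule ℂ M} (h : ∀ i < m a + 1, ∀ z ∈ Z, (D a ^ i) z ∈ X) : Z' ≤ X :=
      iSup_le fun i => Submodule.map_le_iff_le_comap.2 fun z hz => h i i.2 z hz
    refine ⟨Z', inferInstance, hZZ' huZ, hle fun i _ z hz => hVpow a i z (hZV hz),
      hWZ.trans hZZ', fun k => ?_, fun k hk => ?_⟩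
    · have : Z' ≤ W.comap (D k ^ m k) := hle fun i _ z hz => by
        rw [Submodule.mem_comap, ← Module.End.mul_apply, ((hD k a).pow_pow _ _).eq]
        exact hWpow a i _ (hZm k z hz)
      exact this
    · refine hle fun i hi z hz => ?_
      rw [Submodule.mem_comap, ← Module.End.mul_apply]
      obtain rfl | hks := Finset.mem_insert.1 hk
      · rw [← pow_succ']
        obtain hi' | hi' := (Nat.lt_succ_iff.1 hi).lt_or_eq
        · exact hmem _ (Nat.succ_lt_succ hi') hz
        · rw [hi', pow_succ']
          exact hZZ' (hWZ (hWD k (hZm k z hz)))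
      · rw [((hD k a).pow_right i).eq]
        exact hmem i hi (hZs k hks hz)

/-- The binomial theorem for the commuting operators `τ h` and `-1`; it identifies forward
differences with powers of `τ h - 1`. -/
theorem sub_one_pow_apply {τ : Eucl d → Module.End ℂ M} (h0 : τ 0 = 1)
    (hadd : ∀ x y, τ (x + y) = τ x * τ y) (h : Eucl d) (m : ℕ) (u : M) :
    ((τ h - 1) ^ m) u = ∑ k ∈ Finset.range (m + 1),
      ((-1 : ℂ) ^ (m - k) * (m.choose k : ℂ)) • τ ((k : ℝ) • h) u := by
  have hpow (k : ℕ) : τ ((k : ℝ) • h) = τ h ^ k := by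
    induction k with
    | zero => simpa using h0
    | succ k ih => rw [pow_succ, ← ih, ← hadd]; push_cast; rw [add_smul, one_smul]
  rw [sub_eq_add_neg, (Commute.one_right (τ h)).neg_right.add_pow, LinearMap.sum_apply]
  refine Finset.sum_congr rfl fun k _ => ?_
  have : τ h ^ k * (-1) ^ (m - k) * ((m.choose k : ℕ) : Module.End ℂ M) =
      ((-1 : ℂ) ^ (m - k) * (m.choose k : ℂ)) • τ h ^ k := by
    rw [show (-1 : Module.End ℂ M) = algebraMap ℂ _ (-1) by simp, ← map_pow,
      show ((m.choose k : ℕ) : Module.End ℂ M) = algebraMap ℂ _ (m.choose k : ℂ) by simp,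
      mul_assoc, ← map_mul, ← Algebra.commutes, ← Algebra.smul_def]
  rw [this, hpow]
  rfl

variable [TopologicalSpace M] [IsTopologicalAddGroup M] [ContinuousSMul ℂ M] [T2Space M]

/-- A finite-dimensional space of vectors with continuous orbits that is invariant under the
generators of a dense subgroup is invariant under the whole group. -/
theorem invariant_of_dense {τ : Eucl d → Module.End ℂ M} (h0 : τ 0 = 1)
    (hadd : ∀ x y, τ (x + y) = τ x * τ y) {ι : Type*} {h : ι → Eucl d}
    (hdense : Dense (AddSubgroup.closure (Set.range h) : Set (Eucl d)))
    {Z : Submodule ℂ M} [FiniteDimensional ℂ Z] (hcont : ∀ z ∈ Z, Continuous fun x => τ x z)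
    (hZ : ∀ k, Z ≤ Z.comap (τ (h k))) (x : Eucl d) : Z ≤ Z.comap (τ x) := by
  let G : AddSubgroup (Eucl d) :=
    { carrier := {x | Z ≤ Z.comap (τ x)}
      zero_mem' := by
        intro z hz
        rw [Submodule.mem_comap, h0]
        exact hz
      add_mem' := by
        intro x y hx hy z hz
        rw [Submodule.mem_comap, hadd]
        exact hx (hy hz)
      neg_mem' := by
        intro x hx z hz
        -- An injective endomorphism of a finite-dimensional space is onto, so `τ x` maps `Z` onto
        -- itself and its inverse preserves `Z`.
        let f : Z →ₗ[ℂ] Z := (τ x).restrict hx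
        have hinv (z : M) : τ (-x) (τ x z) = z := by
          rw [← Module.End.mul_apply, ← hadd, neg_add_cancel, h0, Module.End.one_apply]
        have hf : Function.Injective f := by
          intro a b hab
          have := congrArg (fun z : Z => τ (-x) z) hab
          simpa [f, hinv, LinearMap.restrict_apply] using this
        obtain ⟨y, hy⟩ := LinearMap.injective_iff_surjective.1 hf ⟨z, hz⟩
        have hy' : τ x y = z := congrArg Subtype.val hy
        rw [Submodule.mem_comap, ← hy', hinv]
        exact y.2 }
  -- Finite-dimensional subspaces of a Hausdorff topological vector space are closed, and orbits are
  -- continuous.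
  have hcl : IsClosed (G : Set (Eucl d)) := by
    have : (G : Set (Eucl d)) = ⋂ z ∈ Z, (fun x => τ x z) ⁻¹' (Z : Set M) := by
      ext x
      simp only [Set.mem_iInter]
      exact Iff.rfl
    rw [this]
    exact isClosed_biInter fun z hz => (Z.closed_of_finiteDimensional).preimage (hcont z hz)
  have hGle : AddSubgroup.closure (Set.range h) ≤ G := by
    rw [AddSubgroup.closure_le]
    rintro _ ⟨k, rfl⟩
    exact hZ k
  have : x ∈ closure (G : Set (Eucl d)) := hdense.mono hGle x
  rwa [hcl.closure_eq] at this

/-- Coordinates on a finite-dimensional invariant space turn the action into a norm-continuous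
representation. -/
theorem exists_representation {τ : Eucl d → Module.End ℂ M} (h0 : τ 0 = 1)
    (hadd : ∀ x y, τ (x + y) = τ x * τ y)
    {Z : Submodule ℂ M} [FiniteDimensional ℂ Z] (hcont : ∀ z ∈ Z, Continuous fun x => τ x z)
    (hZ : ∀ x, Z ≤ Z.comap (τ x)) :
    ∃ (n : ℕ) (b : Z ≃ₗ[ℂ] (Fin n → ℂ)) (ρ : Eucl d → (Fin n → ℂ) →L[ℂ] (Fin n → ℂ)),
      Continuous ρ ∧ ρ 0 = 1 ∧ (∀ x y, ρ (x + y) = ρ x * ρ y) ∧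
      ∀ x v, (b.symm (ρ x v) : M) = τ x (b.symm v) := by
  let b := (Module.finBasis ℂ Z).equivFun
  let ρ : Eucl d → (Fin _ → ℂ) →L[ℂ] (Fin _ → ℂ) := fun x => LinearMap.toContinuousLinearMap
    (b.toLinearMap ∘ₗ (τ x).restrict (hZ x) ∘ₗ b.symm.toLinearMap)
  have hρ (x v) : (b.symm (ρ x v) : M) = τ x (b.symm v) := by
    simp [ρ, LinearMap.restrict_apply]
  have hinj {v w : Fin (Module.finrank ℂ Z) → ℂ} (h : (b.symm v : M) = b.symm w) : v = w :=
    b.symm.injective (Subtype.ext h)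
  refine ⟨_, b, ρ, ?_, ?_, ?_, hρ⟩
  · rw [continuous_clm_apply]
    intro v
    have hb : Continuous b := b.toLinearMap.continuous_of_finiteDimensional
    exact hb.comp ((hcont _ (b.symm v).2).subtype_mk fun x => hZ x (b.symm v).2)
  · ext1 v
    apply hinj
    rw [hρ, h0]
    rfl
  · intro x y
    ext1 v
    apply hinj
    rw [hρ, hadd, Module.End.mul_apply, mul_apply_eq_comp (ρ x), hρ, hρ]

/-- This is a matrix coefficient of the action on `Z`; `l` needs no continuity because only its
restriction to the finite-dimensional `Z` enters. -/
theorem isExpPoly_orbit {τ : Eucl d → Module.End ℂ M} (h0 : τ 0 = 1)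
    (hadd : ∀ x y, τ (x + y) = τ x * τ y)
    {Z : Submodule ℂ M} [FiniteDimensional ℂ Z] (hcont : ∀ z ∈ Z, Continuous fun x => τ x z)
    (hZ : ∀ x, Z ≤ Z.comap (τ x)) {z : M} (hz : z ∈ Z) (l : M →ₗ[ℂ] ℂ) :
    IsExpPoly fun x => l (τ x z) := by
  obtain ⟨n, b, ρ, hρ, hρ0, hρadd, hb⟩ := exists_representation h0 hadd hcont hZ
  have := isExpPoly_representation hρ hρ0 hρadd (l ∘ₗ Z.subtype ∘ₗ b.symm.toLinearMap) (b ⟨z, hz⟩)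
  simpa [hb] using this

/-- If all the differences of `u` along generators of a dense subgroup lie in a finite-dimensional
invariant space, then `u` itself lies in a finite-dimensional invariant space. -/
theorem exists_invariant_of_sub_one_pow {τ : Eucl d → Module.End ℂ M} (h0 : τ 0 = 1)
    (hadd : ∀ x y, τ (x + y) = τ x * τ y) {ι : Type*} [Finite ι] {h : ι → Eucl d}
    (hdense : Dense (AddSubgroup.closure (Set.range h) : Set (Eucl d)))
    {V W : Submodule ℂ M} (hcont : ∀ v ∈ V, Continuous fun x => τ x v)
    (hV : ∀ x, V ≤ V.comap (τ x)) (hW : ∀ x, W ≤ W.comap (τ x)) (hWV : W ≤ V)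
    [FiniteDimensional ℂ W] {m : ι → ℕ} {u : M} (hu : u ∈ V)
    (hm : ∀ k, ((τ (h k) - 1) ^ m k) u ∈ W) :
    ∃ Z : Submodule ℂ M, FiniteDimensional ℂ Z ∧ u ∈ Z ∧ Z ≤ V ∧ ∀ x, Z ≤ Z.comap (τ x) := by
  have hcomm (x y : Eucl d) : Commute (τ x) (τ y) := by
    rw [commute_iff_eq, ← hadd, ← hadd, add_comm]
  obtain ⟨Z, hfin, huZ, hZV, hZ⟩ := exists_finiteDimensional_invariant
    (D := fun k => τ (h k) - 1) (fun j k => ((hcomm _ _).sub_left (Commute.one_left _)).sub_right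
      (Commute.one_right _)) hWV (fun k v hv => show τ (h k) v - v ∈ V from sub_mem (hV _ hv) hv)
    (fun k v hv => show τ (h k) v - v ∈ W from sub_mem (hW _ hv) hv) hu hm
  refine ⟨Z, hfin, huZ, hZV,
    invariant_of_dense h0 hadd hdense (fun z hz => hcont z (hZV hz)) fun k z hz => ?_⟩
  have h1 : τ (h k) z - z ∈ Z := hZ k hz
  simpa using add_mem h1 hz

end Invariant

/-! ### Continuous functions. -/

theorem isExpPoly_of_funDiff {ι : Type*} [Finite ι] {h : ι → Eucl d}
    (hdense : Dense (AddSubgroup.closure (Set.range h) : Set (Eucl d))) {m : ι → ℕ}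
    {f : Eucl d → ℂ} (hf : Continuous f) (hm : ∀ k, IsExpPoly (funDiff (h k) (m k) f)) :
    IsExpPoly f := by
  let τ : Eucl d → Module.End ℂ (Eucl d → ℂ) := fun y => LinearMap.funLeft ℂ ℂ (· + y)
  have h0 : τ 0 = 1 := by ext f x; simp [τ, LinearMap.funLeft_apply]
  have hadd (x y : Eucl d) : τ (x + y) = τ x * τ y := by
    ext f z
    simp [τ, LinearMap.funLeft_apply, add_assoc]
  obtain ⟨W, hWfin, hWm, hWc, hWτ⟩ := exists_invariant_of_isExpPoly hm
  let V : Submodule ℂ (Eucl d → ℂ) :=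
    { carrier := {f | Continuous f}
      add_mem' := fun ha hb => Continuous.add ha hb
      zero_mem' := continuous_const
      smul_mem' := fun c _ hf => Continuous.const_smul hf c }
  -- Continuity for pointwise convergence suffices, since a finite-dimensional space has only one
  -- Hausdorff vector topology.
  have hVc (v) (hv : v ∈ V) : Continuous fun x => τ x v :=
    continuous_pi fun y => Continuous.comp hv (by fun_prop)
  obtain ⟨Z, hZfin, hfZ, hZV, hZ⟩ := exists_invariant_of_sub_one_pow h0 hadd hdense (V := V) (W := W)
    (m := m) (u := f) hVc
    (fun x v hv => show Continuous fun y => v (y + x) from Continuous.comp hv (by fun_prop)) (fun x v hv => hWτ v hv x)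
    (fun v hv => hWc v hv) hf fun k => by
      convert hWm k using 1
      rw [sub_one_pow_apply h0 hadd]
      ext x
      simp [funDiff, τ, LinearMap.funLeft_apply]
  have := isExpPoly_orbit h0 hadd (fun z hz => hVc z (hZV hz)) hZ hfZ (LinearMap.proj 0)
  simpa [τ, LinearMap.funLeft_apply] using this

/-! ### Derivatives of convolutions. -/

section Convolution

open scoped Convolution

/-- Each derivative falls on the smooth, compactly supported factor; the currying equivalence is
continuous linear, so it commutes with the integral. -/
theorem iteratedFDeriv_convolution_right {E F : Type*} [NormedAddCommGroup E] [NormedSpace ℝ E]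
    [MeasurableSpace E] [BorelSpace E] [NormedAddCommGroup F] [NormedSpace ℝ F]
    [CompleteSpace F] (μ : Measure E) [SFinite μ] [μ.IsAddLeftInvariant]
    {f : E → ℝ} {g : E → F} (hf : LocallyIntegrable f μ)
    (hg : ContDiff ℝ (⊤ : ℕ∞) g) (hgc : HasCompactSupport g) (i : ℕ) :
    iteratedFDeriv ℝ i (f ⋆[ContinuousLinearMap.lsmul ℝ ℝ, μ] g) =
      f ⋆[ContinuousLinearMap.lsmul ℝ ℝ, μ] iteratedFDeriv ℝ i g := by
  induction i with
  | zero =>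
    ext1 y
    simp only [iteratedFDeriv_zero_eq_comp, convolution_def, Function.comp_apply]
    rw [← LinearIsometryEquiv.coe_toContinuousLinearEquiv,
      ← ContinuousLinearEquiv.integral_comp_comm]
    simp
  | succ i ih =>
    ext1 y
    have hgi : ContDiff ℝ 1 (iteratedFDeriv ℝ i g) :=
      hg.iteratedFDeriv_right (by exact_mod_cast le_top)
    rw [iteratedFDeriv_succ_eq_comp_left, Function.comp_apply, ih,
      ((hgc.iteratedFDeriv i).hasFDerivAt_convolution_right _ hf hgi y).fderiv]
    simp only [convolution_def]
    refine (ContinuousLinearEquiv.integral_comp_comm (𝕜 := ℝ) (μ := μ)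
      (E := E →L[ℝ] E [×i]→L[ℝ] F) (F := E [×(i + 1)]→L[ℝ] F)
      (continuousMultilinearCurryLeftEquiv ℝ
        (fun _ : Fin (i + 1) => E) F).symm.toContinuousLinearEquiv
      fun t => f t • fderiv ℝ (iteratedFDeriv ℝ i g) (y - t)).symm.trans ?_
    refine integral_congr_ae (Filter.Eventually.of_forall fun t => ?_)
    simp only [iteratedFDeriv_succ_eq_comp_left, Function.comp_apply,
      ContinuousLinearMap.lsmul_apply, map_smul]
    rfl

end Convolution

/-! ### Distributions as functionals of finitely many derivatives, and smoothing. -/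

section Jet

/-- The `i`-th derivative of a test function as a bounded continuous function. -/
noncomputable def jet (i : ℕ) (φ : TestFn d) :
    BoundedContinuousFunction (Eucl d) ((Eucl d) [×i]→L[ℝ] ℝ) :=
  BoundedContinuousFunction.ofNormedAddCommGroup (iteratedFDeriv ℝ i φ)
    (φ.contDiff.continuous_iteratedFDeriv (by exact_mod_cast le_top))
    _ (Classical.choose_spec (Continuous.bounded_above_of_compact_support
      (φ.contDiff.continuous_iteratedFDeriv (m := i) (by exact_mod_cast le_top))
      (φ.hasCompactSupport.iteratedFDeriv i)))

@[simp]
theorem jet_apply (i : ℕ) (φ : TestFn d) (y : Eucl d) :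
    jet i φ y = iteratedFDeriv ℝ i φ y := rfl

/-- A continuous compactly supported derivative is uniformly continuous, so its translates vary
continuously in the sup norm. -/
theorem continuous_jet_translate (i : ℕ) (φ : TestFn d) :
    Continuous fun x => jet i (translate x φ) := by
  have huc : UniformContinuous (iteratedFDeriv ℝ i φ) :=
    (φ.hasCompactSupport.iteratedFDeriv i).uniformContinuous_of_continuous
      (φ.contDiff.continuous_iteratedFDeriv (by exact_mod_cast le_top))
  rw [Metric.continuous_iff]
  intro x ε hε
  obtain ⟨δ, hδ, h⟩ := Metric.uniformContinuous_iff.1 huc (ε / 2) (by positivity)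
  refine ⟨δ, hδ, fun a ha => lt_of_le_of_lt ?_ (half_lt_self hε)⟩
  rw [BoundedContinuousFunction.dist_le (by positivity)]
  intro y
  simp only [jet_apply]
  have htr (x : Eucl d) :
      iteratedFDeriv ℝ i (translate x φ) y = iteratedFDeriv ℝ i φ (y + x) := by
    rw [← iteratedFDeriv_comp_add_right]
    rfl
  rw [htr, htr]
  exact (h (by simpa using ha)).le

/-- A linear form dominated by the norm of `J` factors through `J`. -/
theorem exists_continuousLinearMap_comp_eq {M X : Type*} [AddCommGroup M] [Module ℝ M]
    [NormedAddCommGroup X] [NormedSpace ℝ X] (J : M →ₗ[ℝ] X) (T : M →ₗ[ℝ] ℂ) {C : ℝ}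
    (h : ∀ v, ‖T v‖ ≤ C * ‖J v‖) : ∃ L : X →L[ℝ] ℂ, ∀ v, L (J v) = T v := by
  have hker : LinearMap.ker J ≤ LinearMap.ker T := by
    intro v hv
    have := h v
    rw [LinearMap.mem_ker] at hv ⊢
    rwa [hv, norm_zero, mul_zero, norm_le_zero_iff] at this
  let g : LinearMap.range J →ₗ[ℝ] ℂ :=
    (LinearMap.ker J).liftQ T hker ∘ₗ J.quotKerEquivRange.symm.toLinearMap
  have hg (v) : g ⟨J v, v, rfl⟩ = T v := by
    have : J.quotKerEquivRange.symm ⟨J v, v, rfl⟩ = (LinearMap.ker J).mkQ v := by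
      rw [LinearEquiv.symm_apply_eq]
      rfl
    simp [g, this]
  let g' : LinearMap.range J →L[ℝ] ℂ := g.mkContinuous C (by
    rintro ⟨_, v, rfl⟩
    rw [hg]
    exact h v)
  -- Hahn–Banach for functionals with values in `ℂ`, a finite-dimensional real space.
  obtain ⟨L, hL⟩ := g'.exist_extension_of_finiteDimensional_range
  refine ⟨L, fun v => ?_⟩
  rw [← hg v]
  exact (congrArg (fun l => l ⟨J v, v, rfl⟩) hL).symm

/-- Tuples of bounded continuous functions in which finitely many derivatives take values. -/
def JetSpace (d : ℕ) (s : Finset ℕ) : Type :=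
  Π i : s, BoundedContinuousFunction (Eucl d) ((Eucl d) [×(i : ℕ)]→L[ℝ] ℝ)

noncomputable instance (s : Finset ℕ) : NormedAddCommGroup (JetSpace d s) :=
  inferInstanceAs (NormedAddCommGroup
    (Π i : s, BoundedContinuousFunction (Eucl d) ((Eucl d) [×(i : ℕ)]→L[ℝ] ℝ)))

noncomputable instance (s : Finset ℕ) : NormedSpace ℝ (JetSpace d s) :=
  inferInstanceAs (NormedSpace ℝ
    (Π i : s, BoundedContinuousFunction (Eucl d) ((Eucl d) [×(i : ℕ)]→L[ℝ] ℝ)))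

instance (s : Finset ℕ) : CompleteSpace (JetSpace d s) :=
  inferInstanceAs (CompleteSpace
    (Π i : s, BoundedContinuousFunction (Eucl d) ((Eucl d) [×(i : ℕ)]→L[ℝ] ℝ)))

/-- The derivatives of a test function with orders in `s`. -/
noncomputable def jets (s : Finset ℕ) (φ : TestFn d) : JetSpace d s := fun i => jet i φ

theorem continuous_jets_translate (s : Finset ℕ) (φ : TestFn d) :
    Continuous fun x => jets s (translate x φ) :=
  continuous_pi fun i : s => continuous_jet_translate i φ

/-- The evaluation of the derivative of order `i` at a point. -/
noncomputable def JetSpace.eval {s : Finset ℕ} (i : s) (y : Eucl d) :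
    JetSpace d s →L[ℝ] ((Eucl d) [×(i : ℕ)]→L[ℝ] ℝ) :=
  (BoundedContinuousFunction.evalCLM ℝ y).comp (ContinuousLinearMap.proj (R := ℝ)
    (φ := fun i : s => BoundedContinuousFunction (Eucl d) ((Eucl d) [×(i : ℕ)]→L[ℝ] ℝ)) i)

/-- On test functions supported in a fixed compact set, a distribution is a continuous linear
function of finitely many derivatives. -/
theorem exists_eq_jet (T : Distr d) (K : Compacts (Eucl d)) :
    ∃ (s : Finset ℕ) (L : JetSpace d s →L[ℝ] ℂ),
      ∀ φ : TestFn d, Function.support φ ⊆ K → T φ = L (jets s φ) := by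
  let inc : 𝓓_{K}(Eucl d, ℝ) →L[ℝ] TestFn d :=
    TestFunction.ofSupportedInCLM ℝ (Ω := ⊤) (fun _ _ => trivial)
  let TK : 𝓓_{K}(Eucl d, ℝ) →ₗ[ℝ] ℂ :=
    { toFun := fun φ => T (inc φ)
      map_add' := fun a b => by simp
      map_smul' := fun c a => by simp }
  have hTK : Continuous TK := (ContinuousLinearMap.continuous T).comp inc.continuous
  obtain ⟨s, C, -, hC⟩ := Seminorm.bound_of_continuous
    (ContDiffMapSupportedIn.withSeminorms ℝ (Eucl d) ℝ ⊤ K) ((normSeminorm ℝ ℂ).comp TK)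
    (continuous_norm.comp hTK)
  let J : 𝓓_{K}(Eucl d, ℝ) →ₗ[ℝ] JetSpace d s :=
    LinearMap.pi (φ := fun i : s => BoundedContinuousFunction (Eucl d) ((Eucl d) [×(i : ℕ)]→L[ℝ] ℝ))
      fun i => ContDiffMapSupportedIn.structureMapLM ℝ ⊤ i
  have hbound (φ) : ‖TK φ‖ ≤ C * ‖J φ‖ := by
    refine (hC φ).trans ?_
    simp only [smul_apply, NNReal.smul_def, smul_eq_mul]
    gcongr
    refine Seminorm.finset_sup_apply_le (norm_nonneg _) fun i hi => ?_
    exact norm_le_pi_norm (G := fun i : s =>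
      BoundedContinuousFunction (Eucl d) ((Eucl d) [×(i : ℕ)]→L[ℝ] ℝ)) (J φ) ⟨i, hi⟩
  obtain ⟨L, hL⟩ := exists_continuousLinearMap_comp_eq J TK hbound
  refine ⟨s, L, fun φ hφ => ?_⟩
  let φK : 𝓓_{K}(Eucl d, ℝ) :=
    ContDiffMapSupportedIn.of_support_subset (f := φ) φ.contDiff hφ
  have h1 : inc φK = φ := by ext; rfl
  have h2 : J φK = jets s φ := by
    funext i
    apply DFunLike.coe_injective
    exact ContDiffMapSupportedIn.structureMapLM_top_apply ℝ φK
  rw [← h2, hL]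
  exact congrArg T h1.symm

theorem support_translate_subset {φ : TestFn d} {x : Eucl d} {A : Set (Eucl d)} (hx : -x ∈ A) :
    Function.support (translate x φ) ⊆ (fun p : Eucl d × Eucl d => p.1 + p.2) '' tsupport φ ×ˢ A := by
  intro y hy
  refine ⟨(y + x, -x), ⟨subset_tsupport _ hy, hx⟩, by simp⟩

/-- Continuity is local in `x`: over a unit ball all translates of `φ` are supported in one compact
set, where `T` factors continuously through jets. -/
theorem continuous_distr_translate (T : Distr d) (φ : TestFn d) :
    Continuous fun x => T (translate x φ) := by
  rw [continuous_iff_continuousAt]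
  intro x
  let K : Compacts (Eucl d) :=
    ⟨(fun p : Eucl d × Eucl d => p.1 + p.2) '' tsupport φ ×ˢ Metric.closedBall (-x) 1,
      (φ.hasCompactSupport.isCompact.prod (isCompact_closedBall _ _)).image (by fun_prop)⟩
  obtain ⟨s, L, hL⟩ := exists_eq_jet T K
  have hcont : Continuous fun x => L (jets s (translate x φ)) :=
    L.continuous.comp (continuous_jets_translate s φ)
  refine hcont.continuousAt.congr ?_
  filter_upwards [Metric.closedBall_mem_nhds x one_pos] with a ha
  refine (hL _ (support_translate_subset ?_)).symm
  simpa [dist_neg_neg] using ha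

/-- Both sides are the value of `T` at the convolution of `φ` and `ψ`. -/
theorem integral_mul_distr_translate_comm (T : Distr d) (φ ψ : TestFn d) :
    ∫ x, (ψ x : ℂ) * T (translate (-x) φ) = ∫ x, (φ x : ℂ) * T (translate (-x) ψ) := by
  let K : Compacts (Eucl d) :=
    ⟨(fun p : Eucl d × Eucl d => p.1 + p.2) '' tsupport φ ×ˢ tsupport ψ,
      (φ.hasCompactSupport.isCompact.prod ψ.hasCompactSupport.isCompact).image (by fun_prop)⟩
  obtain ⟨s, L, hL⟩ := exists_eq_jet T K
  -- Integrating in the Banach space of jets lets `L` pass through the integral, so the convolution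
  -- need not be built as a test function.
  let G (φ ψ : TestFn d) (x : Eucl d) : JetSpace d s := ψ x • jets s (translate (-x) φ)
  have hGint (φ ψ : TestFn d) : Integrable (G φ ψ) := by
    refine Continuous.integrable_of_hasCompactSupport ?_ ψ.hasCompactSupport.smul_right
    exact ψ.continuous.smul
      ((continuous_jets_translate s φ).comp continuous_neg)
  have hLG (φ ψ : TestFn d)
      (hK : ∀ x ∈ tsupport ψ, Function.support (translate (-x) φ) ⊆ K) :
      ∫ x, (ψ x : ℂ) * T (translate (-x) φ) = L (∫ x, G φ ψ x) := by
    rw [← L.integral_comp_comm (hGint φ ψ)]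
    refine integral_congr_ae (Filter.Eventually.of_forall fun x => ?_)
    simp only [G, map_smul]
    by_cases hx : x ∈ tsupport ψ
    · rw [hL _ (hK x hx), Complex.real_smul]
    · simp [image_eq_zero_of_notMem_tsupport hx]
  have hGapply (φ ψ : TestFn d) (i : s) (y : Eucl d) : JetSpace.eval i y (∫ x, G φ ψ x) =
      ∫ x, ψ x • iteratedFDeriv ℝ i φ (y - x) := by
    rw [← ContinuousLinearMap.integral_comp_comm _ (hGint φ ψ)]
    refine integral_congr_ae (Filter.Eventually.of_forall fun x => ?_)
    change ψ x • iteratedFDeriv ℝ i (translate (-x) φ) y = _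
    beta_reduce
    rw [sub_eq_add_neg, ← iteratedFDeriv_comp_add_right]
    rfl
  have hconv : convolution ψ φ (ContinuousLinearMap.lsmul ℝ ℝ) volume =
      convolution φ ψ (ContinuousLinearMap.lsmul ℝ ℝ) volume := by
    funext y
    rw [convolution_def, convolution_def, ← integral_sub_left_eq_self _ volume y]
    simp [mul_comm]
  -- Evaluated at order `i` and point `y`, the two sides are the `i`-th derivatives of `ψ ⋆ φ` and
  -- `φ ⋆ ψ`.
  have hsymm : ∫ x, G φ ψ x = ∫ x, G ψ φ x := by
    funext i
    refine BoundedContinuousFunction.ext fun y => ?_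
    change JetSpace.eval i y _ = JetSpace.eval i y _
    rw [hGapply, hGapply]
    have h1 := congrFun (iteratedFDeriv_convolution_right volume (f := ψ) (g := φ)
      ψ.continuous.locallyIntegrable φ.contDiff φ.hasCompactSupport i) y
    have h2 := congrFun (iteratedFDeriv_convolution_right volume (f := φ) (g := ψ)
      φ.continuous.locallyIntegrable ψ.contDiff ψ.hasCompactSupport i) y
    rw [convolution_def] at h1 h2
    simp only [ContinuousLinearMap.lsmul_apply] at h1 h2
    rw [← h1, ← h2, hconv]
  rw [hLG φ ψ, hLG ψ φ, hsymm]
  · intro x hx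
    refine (support_translate_subset (A := tsupport φ) (by simpa using hx)).trans ?_
    rintro _ ⟨⟨a, b⟩, ⟨ha, hb⟩, rfl⟩
    exact ⟨(b, a), ⟨hb, ha⟩, add_comm _ _⟩
  · intro x hx
    exact support_translate_subset (by simpa using hx)

end Jet

/-! ### The translation action on distributions. -/

/-- The translation action on functionals on test functions. -/
noncomputable def functionalTranslate (y : Eucl d) : Module.End ℂ (TestFn d → ℂ) :=
  LinearMap.funLeft ℂ ℂ (translate y)

theorem functionalTranslate_apply (y : Eucl d) (u : TestFn d → ℂ) (φ : TestFn d) :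
    functionalTranslate y u φ = u (translate y φ) := rfl

theorem translate_zero (φ : TestFn d) : translate 0 φ = φ := by
  ext x
  simp [translate_apply]

theorem translate_add (x y : Eucl d) (φ : TestFn d) :
    translate (x + y) φ = translate y (translate x φ) := by
  ext z
  simp [translate_apply, add_assoc, add_comm x y]

theorem functionalTranslate_zero : functionalTranslate (0 : Eucl d) = 1 := by
  ext u φ
  simp [functionalTranslate_apply, translate_zero]

theorem functionalTranslate_add (x y : Eucl d) :
    functionalTranslate (x + y) = functionalTranslate x * functionalTranslate y := by
  ext u φ
  simp [functionalTranslate_apply, translate_add]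

/-- The space of distributions inside the space of all functionals on test functions. -/
noncomputable def distrSubmodule (d : ℕ) : Submodule ℂ (TestFn d → ℂ) :=
  LinearMap.range ({ toFun := fun T φ => T φ
                     map_add' := fun _ _ => rfl
                     map_smul' := fun _ _ => rfl } : Distr d →ₗ[ℂ] (TestFn d → ℂ))

theorem mem_distrSubmodule {u : TestFn d → ℂ} :
    u ∈ distrSubmodule d ↔ ∃ T : Distr d, (fun φ => T φ) = u := Iff.rfl

/-- The sign appears because `functionalTranslate` precomposes with translation, while `Δ_h^m T` is
`T` applied to `Δ_{-h}^m φ`. -/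
theorem sub_one_pow_functionalTranslate (h : Eucl d) (m : ℕ) (T : Distr d) :
    ((functionalTranslate (-h) - 1) ^ m) (fun φ => T φ) = fun φ => distrDiff h m T φ := by
  rw [sub_one_pow_apply functionalTranslate_zero functionalTranslate_add]
  ext φ
  rw [distrDiff_apply, testDiff]
  simp [functionalTranslate_apply]

theorem integrable_testFn_smul {B : Type*} [NormedAddCommGroup B] [NormedSpace ℝ B]
    {g : Eucl d → B} (hg : Continuous g) (φ : TestFn d) : Integrable fun x => φ x • g x :=
  Continuous.integrable_of_hasCompactSupport (φ.continuous.smul hg)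
    (φ.hasCompactSupport.smul_right (f' := g))

theorem integrable_testFn_mul {g : Eucl d → ℂ} (hg : Continuous g) (φ : TestFn d) :
    Integrable fun x => (φ x : ℂ) * g x := by
  simpa only [Complex.real_smul] using integrable_testFn_smul hg φ

theorem integral_mem_distrSubmodule {g : Eucl d → ℂ} (hg : Continuous g) :
    (fun φ : TestFn d => ∫ x, (φ x : ℂ) * g x) ∈ distrSubmodule d := by
  let T : TestFn d →L[ℝ] ℂ :=
    TestFunction.integralAgainstBilinCLM (ContinuousLinearMap.lsmul ℝ ℝ) volume g
  let T' : Distr d := { toLinearMap := T.toLinearMap, cont := T.continuous }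
  refine mem_distrSubmodule.2 ⟨T', ?_⟩
  ext φ
  change T φ = _
  refine (TestFunction.integralAgainstBilinCLM_eq_integral
    (hg.locallyIntegrable.locallyIntegrableOn _)).trans ?_
  simp

/-- A finite-dimensional translation-invariant space of distributions containing finitely many
given exponential polynomials. -/
theorem exists_invariant_of_isExpPolyDistr {ι : Type*} [Finite ι] {T : ι → Distr d}
    (hT : ∀ k, IsExpPolyDistr (T k)) :
    ∃ W : Submodule ℂ (TestFn d → ℂ), FiniteDimensional ℂ W ∧ (∀ k, (fun φ => T k φ) ∈ W) ∧
      W ≤ distrSubmodule d ∧ ∀ x, W ≤ W.comap (functionalTranslate x) := by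
  choose g hg hgT using hT
  obtain ⟨S, hS, hgS, hSc, hSt⟩ := exists_invariant_of_isExpPoly hg
  let Λ : S →ₗ[ℂ] (TestFn d → ℂ) :=
    { toFun := fun f φ => ∫ x, (φ x : ℂ) * f.1 x
      map_add' := by
        intro f f'
        ext φ
        simp only [Submodule.coe_add, Pi.add_apply, mul_add]
        exact integral_add (integrable_testFn_mul (hSc f f.2) φ)
          (integrable_testFn_mul (hSc f' f'.2) φ)
      map_smul' := by
        intro c f
        ext φ
        simp only [Submodule.coe_smul, Pi.smul_apply, smul_eq_mul, RingHom.id_apply,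
          mul_left_comm _ c]
        exact integral_const_mul c _ }
  refine ⟨LinearMap.range Λ, inferInstance, fun k => ⟨⟨g k, hgS k⟩, ?_⟩, ?_, ?_⟩
  · ext φ
    exact (hgT k φ).symm
  · rintro _ ⟨f, rfl⟩
    exact integral_mem_distrSubmodule (hSc f f.2)
  · rintro y _ ⟨f, rfl⟩
    -- Translating test functions by `y` translates the density by `-y`.
    refine ⟨⟨_, hSt f f.2 (-y)⟩, ?_⟩
    ext φ
    rw [functionalTranslate_apply]
    change ∫ x, (φ x : ℂ) * f.1 (x + -y) = ∫ x, (φ (x + y) : ℂ) * f.1 x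
    rw [← integral_add_right_eq_self _ y]
    simp

/-! ### Regularity of distributions in a finite-dimensional invariant space. -/

section Smoothing

open scoped Convolution

/-- The average of a continuous representation against a suitable test function is invertible. -/
theorem exists_testFn_isUnit_integral {B : Type*} [NormedRing B] [NormedAlgebra ℝ B]
    [CompleteSpace B] {ρ : Eucl d → B} (hρ : Continuous ρ) (h0 : ρ 0 = 1) :
    ∃ φ : TestFn d, IsUnit (∫ x, φ x • ρ (-x)) := by
  -- A normalized bump supported where `ρ` is within `1/2` of `1` has an average within `1/2` of
  -- `1`, hence invertible by the Neumann series.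
  obtain ⟨δ, hδ, h⟩ := Metric.continuous_iff.1 hρ 0 (1 / 2) (by norm_num)
  let β : ContDiffBump (0 : Eucl d) := ⟨δ / 2, δ, by positivity, half_lt_self hδ⟩
  let φ : TestFn d := ⟨β.normed volume, β.contDiff_normed, β.hasCompactSupport_normed,
    fun _ _ => trivial⟩
  refine ⟨φ, ?_⟩
  have h1 : dist ((β.normed volume ⋆[ContinuousLinearMap.lsmul ℝ ℝ, volume] ρ) 0) (ρ 0) ≤ 1 / 2 :=
    β.dist_normed_convolution_le hρ.aestronglyMeasurable fun x hx => (h x hx).le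
  have h2 : (β.normed volume ⋆[ContinuousLinearMap.lsmul ℝ ℝ, volume] ρ) 0 =
      ∫ x, φ x • ρ (-x) := by
    rw [convolution_def]
    simp only [zero_sub]
    rfl
  rw [h2, h0, dist_eq_norm, norm_sub_rev] at h1
  have h3 := isUnit_one_sub_of_norm_lt_one (h1.trans_lt (by norm_num))
  simpa using h3

end Smoothing

/-- Invertibility of the average gives `S` in `Z` with `T ψ = ∫ φ x * S (translate (-x) ψ)`.
Commutativity of convolution moves the translation onto `φ`, so `T` has density `S (translate (-x)
φ)`, a reflected orbit coefficient. -/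
theorem isExpPolyDistr_of_invariant {Z : Submodule ℂ (TestFn d → ℂ)} [FiniteDimensional ℂ Z]
    (hZd : Z ≤ distrSubmodule d) (hZ : ∀ x, Z ≤ Z.comap (functionalTranslate x)) {T : Distr d}
    (hT : (fun φ => T φ) ∈ Z) : IsExpPolyDistr T := by
  have hcont (z) (hz : z ∈ Z) : Continuous fun x => functionalTranslate x z := by
    obtain ⟨S, rfl⟩ := mem_distrSubmodule.1 (hZd hz)
    exact continuous_pi fun φ => continuous_distr_translate S φ
  obtain ⟨n, b, ρ, hρ, hρ0, hρadd, hb⟩ :=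
    exists_representation functionalTranslate_zero functionalTranslate_add hcont hZ
  obtain ⟨φ, hφ⟩ := exists_testFn_isUnit_integral hρ hρ0
  obtain ⟨v, hv⟩ : ∃ v, (∫ x, φ x • ρ (-x)) v = b ⟨_, hT⟩ := by
    obtain ⟨M, hM⟩ := hφ
    refine ⟨M.inv (b ⟨_, hT⟩), ?_⟩
    rw [← hM]
    exact DFunLike.congr_fun M.val_inv (b ⟨_, hT⟩)
  obtain ⟨S, hS⟩ := mem_distrSubmodule.1 (hZd (b.symm v).2)
  have hSZ : (fun φ => S φ) ∈ Z := hS ▸ (b.symm v).2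
  refine ⟨fun x => S (translate (-x) φ), ?_, fun ψ => ?_⟩
  · exact (isExpPoly_orbit functionalTranslate_zero functionalTranslate_add hcont hZ hSZ
      (LinearMap.proj φ)).comp_neg
  · rw [integral_mul_distr_translate_comm]
    let ev : (Fin n → ℂ) →L[ℂ] ℂ := LinearMap.toContinuousLinearMap
      (LinearMap.proj ψ ∘ₗ Z.subtype ∘ₗ b.symm.toLinearMap)
    have hint : Integrable fun x => φ x • ρ (-x) :=
      integrable_testFn_smul (hρ.comp continuous_neg) φ
    let ev' : ((Fin n → ℂ) →L[ℂ] (Fin n → ℂ)) →L[ℂ] ℂ :=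
      ev.comp (ContinuousLinearMap.apply ℂ (Fin n → ℂ) v)
    have h1 : T ψ = ev' (∫ x, φ x • ρ (-x)) := by
      change _ = ev ((∫ x, φ x • ρ (-x)) v)
      rw [hv]
      simp [ev]
    rw [h1, ← ev'.integral_comp_comm hint]
    refine integral_congr_ae (Filter.Eventually.of_forall fun x => ?_)
    have h2 : ev (ρ (-x) v) = S (translate (-x) ψ) := by
      change (b.symm (ρ (-x) v) : TestFn d → ℂ) ψ = _
      rw [hb, ← hS]
      rfl
    change ev ((φ x • ρ (-x)) v) = (φ x : ℂ) * S (translate (-x) ψ)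
    rw [← h2, smul_apply, ← Complex.coe_smul, map_smul, smul_eq_mul]

theorem isExpPolyDistr_of_distrDiff {ι : Type*} [Finite ι] {h : ι → Eucl d}
    (hdense : Dense (AddSubgroup.closure (Set.range h) : Set (Eucl d))) {m : ι → ℕ} {T : Distr d}
    (hm : ∀ k, IsExpPolyDistr (distrDiff (h k) (m k) T)) : IsExpPolyDistr T := by
  -- The action uses the vectors `-h k`, which generate the same subgroup.
  have hdense' : Dense (AddSubgroup.closure (Set.range fun k => -h k) : Set (Eucl d)) := by
    refine hdense.mono ?_
    rw [SetLike.coe_subset_coe, AddSubgroup.closure_le]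
    rintro _ ⟨k, rfl⟩
    have : -h k ∈ AddSubgroup.closure (Set.range fun k => -h k) :=
      AddSubgroup.subset_closure ⟨k, rfl⟩
    simpa using this
  obtain ⟨W, hWfin, hWm, hWd, hWτ⟩ := exists_invariant_of_isExpPolyDistr hm
  obtain ⟨Z, hZfin, hTZ, hZd, hZ⟩ := exists_invariant_of_sub_one_pow functionalTranslate_zero
    functionalTranslate_add hdense' (V := distrSubmodule d) (W := W) (m := m)
    (u := fun φ => T φ)
    (by
      intro u hu
      obtain ⟨S, rfl⟩ := mem_distrSubmodule.1 hu
      exact continuous_pi fun φ => continuous_distr_translate S φ)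
    (by
      intro x u hu
      obtain ⟨S, rfl⟩ := mem_distrSubmodule.1 hu
      exact mem_distrSubmodule.2 ⟨(translate x).precompCompactConvergenceCLM ℂ S, rfl⟩)
    hWτ hWd (mem_distrSubmodule.2 ⟨T, rfl⟩)
    fun k => by
      rw [sub_one_pow_functionalTranslate]
      exact hWm k
  exact isExpPolyDistr_of_invariant hZd hZ hTZ

end ExpPolyDiff

theorem mainTheorem1 (d t : ℕ) (h : Fin t → ExpPolyDiff.Eucl d)
    (hdense : Dense (AddSubgroup.closure (Set.range h) : Set (ExpPolyDiff.Eucl d)))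
    (m : Fin t → ℕ) :
    (∀ f : C(ExpPolyDiff.Eucl d, ℂ),
      (∀ k : Fin t, ExpPolyDiff.IsExpPoly (ExpPolyDiff.funDiff (h k) (m k) f)) →
        ExpPolyDiff.IsExpPoly f) ∧
    (∀ T : ExpPolyDiff.Distr d,
      (∀ k : Fin t, ExpPolyDiff.IsExpPolyDistr (ExpPolyDiff.distrDiff (h k) (m k) T)) →
        ExpPolyDiff.IsExpPolyDistr T) :=
  ⟨fun f hf => ExpPolyDiff.isExpPoly_of_funDiff hdense f.continuous hf,
    fun _ hT => ExpPolyDiff.isExpPolyDistr_of_distrDiff hdense hT⟩
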